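/- Let $\mathcal A=(\mathcal P,\mathcal L,\mathcal I)$ be a Desargues affine plane, i.e. an incidence structure of points and lines such that two distinct points lie on exactly one line, through a point off a line $\ell$ there is exactly one line missing $\ell$, there are three non-collinear points, and Desargues' axiom holds: if the lines $AA'$, $BB'$, $CC'$ (with $A\ne A'$, $B\ne B'$, $C\ne C'$) are pairwise distinct and either all parallel or all through one point, $A,B,C$ are distinct, $A',B',C'$ are distinct, $AB\parallel A'B'$ and $BC\parallel B'C'$, then $AC\parallel A'C'$ (lines are parallel if they are equal or have no common point). Let $O\neq I$ be points, $\ell^{OI}$ the line through them, and $B_1\notin\ell^{OI}$ an auxiliary point. For $A,B\in\ell^{OI}$ define points of $\ell^{OI}$ as follows. * $A+B$: let $P_1$ be the intersection of the parallel to $\ell^{OI}$ through $B_1$ with the parallel to $OB_1$ through $A$; then $A+B$ is the intersection of $\ell^{OI}$ with the parallel to $BB_1$ through $P_1$. * $A\cdot B$: let $P_1$ be the intersection of the parallel to $IB_1$ through $A$ with $OB_1$; then $A\cdot B$ is the intersection of $\ell^{OI}$ with the parallel to $BB_1$ through $P_1$. * $-A$ is the point with $A+(-A)=O$, $A-B=A+(-B)$,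 and for $A\ne O$, $A^{-1}$ is the point with $A\cdot A^{-1}=I$. * For $A,B,C\in\ell^{OI}$ with $B\neq C$, the ratio of the three points is $r(A,B;C)=(B-C)^{-1}\cdot(A-C)$. * For $n\in\mathbb N$, the natural dilatation is $\delta_n(A)=nA=\underbrace{A+\cdots+A}_{n}$ (with $0A=O$). **Theorem.** Let $n\in\mathbb N$ be such that $nI\neq O$. Then for all $A,B,C\in\ell^{OI}$ with $B\ne C$ one has $nB\neq nC$ (so that the ratio of $nA,nB,nC$ is defined), and $$r(nA,nB;nC)=r(A,B;C).$$ -/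

import Mathlib

/-! Desargues affine planes, and the addition, multiplication and ratio of points
on a line `OI` of such a plane. -/

noncomputable section

/-- An affine plane with points `P` and lines `L`; incidence is `p ∈ l`. -/
class AffinePlane (P L : Type*) [Membership P L] : Prop where
  /-- Two distinct points lie on exactly one line. -/
  existsUnique_line : ∀ p q : P, p ≠ q → ∃! l : L, p ∈ l ∧ q ∈ l
  /-- Playfair: through a point off `l` there is exactly one line that misses `l`. -/
  playfair : ∀ (p : P) (l : L), p ∉ l → ∃! m : L, p ∈ m ∧ ∀ x : P, x ∈ l → x ∉ m
  /-- There are three non-collinear points. -/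
  exists_triangle : ∃ p q r : P, p ≠ q ∧ p ≠ r ∧ q ≠ r ∧
    ∀ l : L, ¬ (p ∈ l ∧ q ∈ l ∧ r ∈ l)

namespace AffinePlane

variable {P L : Type*} [Membership P L]

/-- Lines are parallel when they are equal or have no common point. -/
def Parallel (P : Type*) {L : Type*} [Membership P L] (l m : L) : Prop :=
  l = m ∨ ∀ x : P, x ∈ l → x ∉ m

theorem eq_of_parallel {l m : L} (h : Parallel P l m) {p : P} (hl : p ∈ l) (hm : p ∈ m) :
    l = m :=
  h.elim id fun h => absurd hm (h p hl)

theorem parallel_symm {l m : L} (h : Parallel P l m) : Parallel P m l :=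
  h.elim (fun h => Or.inl h.symm) fun h => Or.inr fun x hm hl => h x hl hm

theorem exists_meet {l m : L} (h : ¬ Parallel P l m) : ∃ p : P, p ∈ l ∧ p ∈ m := by
  by_contra hn
  exact h (Or.inr fun x hl hm => hn ⟨x, hl, hm⟩)

/-- The common point of two lines that are not parallel. -/
def meet (l m : L) (h : ¬ Parallel P l m) : P := Classical.choose (exists_meet h)

theorem meet_mem_left {l m : L} (h : ¬ Parallel P l m) : meet l m h ∈ l :=
  (Classical.choose_spec (exists_meet h)).1

theorem meet_mem_right {l m : L} (h : ¬ Parallel P l m) : meet l m h ∈ m :=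
  (Classical.choose_spec (exists_meet h)).2

variable [AffinePlane P L]

theorem exists_line (p q : P) : ∃ l : L, p ∈ l ∧ q ∈ l := by
  by_cases h : p = q
  · subst h
    obtain ⟨a, b, c, hab, -⟩ := exists_triangle (P := P) (L := L)
    by_cases hp : p = a
    · subst hp
      obtain ⟨l, hl, -⟩ := existsUnique_line (L := L) p b hab
      exact ⟨l, hl.1, hl.1⟩
    · obtain ⟨l, hl, -⟩ := existsUnique_line (L := L) p a hp
      exact ⟨l, hl.1, hl.1⟩
  · exact (existsUnique_line p q h).exists

theorem line_unique {p q : P} (h : p ≠ q) {l m : L} (hpl : p ∈ l) (hql : q ∈ l)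
    (hpm : p ∈ m) (hqm : q ∈ m) : l = m :=
  (existsUnique_line p q h).unique ⟨hpl, hql⟩ ⟨hpm, hqm⟩

variable (L) in
/-- The line through `p` and `q` (some line through `p` if `p = q`). -/
def join (p q : P) : L := Classical.choose (exists_line p q)

theorem left_mem_join (p q : P) : p ∈ join L p q :=
  (Classical.choose_spec (exists_line (L := L) p q)).1

theorem right_mem_join (p q : P) : q ∈ join L p q :=
  (Classical.choose_spec (exists_line (L := L) p q)).2

theorem parallel_trans {l m k : L} (h : Parallel P l m) (h' : Parallel P m k) :
    Parallel P l k := by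
  rcases h with rfl | h
  · exact h'
  rcases h' with rfl | h'
  · exact Or.inr h
  by_cases hx : ∃ x : P, x ∈ l ∧ x ∈ k
  · obtain ⟨x, hl, hk⟩ := hx
    exact Or.inl ((playfair x m (h x hl)).unique ⟨hl, fun y hm hy => h y hy hm⟩ ⟨hk, h'⟩)
  · exact Or.inr fun x hl hk => hx ⟨x, hl, hk⟩

theorem exists_par (l : L) (p : P) : ∃ m : L, p ∈ m ∧ Parallel P m l := by
  by_cases h : p ∈ l
  · exact ⟨l, h, Or.inl rfl⟩
  · obtain ⟨m, ⟨hm, hd⟩, -⟩ := playfair p l h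
    exact ⟨m, hm, Or.inr fun x hxm hxl => hd x hxl hxm⟩

/-- The line through `p` parallel to `l`. -/
def par (l : L) (p : P) : L := Classical.choose (exists_par l p)

theorem mem_par (l : L) (p : P) : p ∈ par l p := (Classical.choose_spec (exists_par l p)).1

theorem par_parallel (l : L) (p : P) : Parallel P (par l p) l :=
  (Classical.choose_spec (exists_par l p)).2

theorem eq_meet {l m : L} (h : ¬ Parallel P l m) {p : P} (hl : p ∈ l) (hm : p ∈ m) :
    meet l m h = p := by
  by_contra hn
  exact h (Or.inl (line_unique hn (meet_mem_left h) hl (meet_mem_right h) hm))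

end AffinePlane

open AffinePlane in
/-- A Desargues affine plane: if the lines `AA'`, `BB'`, `CC'` are distinct and either all
parallel or concurrent, and `AB ∥ A'B'` and `BC ∥ B'C'`, then `AC ∥ A'C'`. -/
class DesarguesAffinePlane (P L : Type*) [Membership P L] : Prop extends AffinePlane P L where
  desargues : ∀ A B C A' B' C' : P,
    A ≠ A' → B ≠ B' → C ≠ C' →
    A ≠ B → B ≠ C → A ≠ C → A' ≠ B' → B' ≠ C' → A' ≠ C' →
    join L A A' ≠ join L B B' → join L B B' ≠ join L C C' → join L A A' ≠ join L C C' →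
    ((Parallel P (join L A A') (join L B B') ∧ Parallel P (join L B B') (join L C C')) ∨
      ∃ V : P, V ∈ join L A A' ∧ V ∈ join L B B' ∧ V ∈ join L C C') →
    Parallel P (join L A B) (join L A' B') →
    Parallel P (join L B C) (join L B' C') →
    Parallel P (join L A C) (join L A' C')

/-- A line `OI` given by two distinct points, together with the auxiliary point `B₁` off the
line that the constructions of sums and products of points start from. -/
structure LineFrame (P L : Type*) [Membership P L] [AffinePlane P L] where
  O : P
  I : P
  B₁ : P
  O_ne_I : O ≠ I
  B₁_notMem : B₁ ∉ AffinePlane.join L O I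

namespace LineFrame

open AffinePlane

variable {P L : Type*} [Membership P L] [AffinePlane P L] (ℓ : LineFrame P L)

/-- The line `OI`. -/
def line : L := join L ℓ.O ℓ.I

/-- The points of the line `OI`. -/
def Pt : Type _ := {X : P // X ∈ ℓ.line}

/-- The point `O` of the line `OI`. -/
def zero : ℓ.Pt := ⟨ℓ.O, left_mem_join _ _⟩

/-- The point `I` of the line `OI`. -/
def one : ℓ.Pt := ⟨ℓ.I, right_mem_join _ _⟩

theorem not_parallel_line {B : P} (hB : B ∈ ℓ.line) :
    ¬ Parallel P (join L B ℓ.B₁) ℓ.line := fun h => by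
  have e : join L B ℓ.B₁ = join L ℓ.O ℓ.I := eq_of_parallel h (left_mem_join _ _) hB
  exact ℓ.B₁_notMem (e ▸ right_mem_join B ℓ.B₁)

theorem not_parallel_par {B : P} (hB : B ∈ ℓ.line) (Q : P) :
    ¬ Parallel P (par (join L B ℓ.B₁) Q) ℓ.line := fun h =>
  ℓ.not_parallel_line hB (parallel_trans (parallel_symm (par_parallel _ _)) h)

theorem not_parallel_sum (A : P) :
    ¬ Parallel P (par ℓ.line ℓ.B₁) (par (join L ℓ.O ℓ.B₁) A) := fun h =>
  ℓ.not_parallel_line ℓ.zero.2 (parallel_symm (parallel_trans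
    (parallel_symm (par_parallel ℓ.line ℓ.B₁)) (parallel_trans h (par_parallel _ _))))

theorem not_parallel_prod (A : P) :
    ¬ Parallel P (par (join L ℓ.I ℓ.B₁) A) (join L ℓ.O ℓ.B₁) := fun h => by
  have e : join L ℓ.I ℓ.B₁ = join L ℓ.O ℓ.B₁ :=
    eq_of_parallel (parallel_trans (parallel_symm (par_parallel _ A)) h)
      (right_mem_join _ _) (right_mem_join _ _)
  have hI : ℓ.I ∈ join L ℓ.O ℓ.B₁ := e ▸ left_mem_join ℓ.I ℓ.B₁
  have e' : join L ℓ.O ℓ.B₁ = join L ℓ.O ℓ.I :=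
    line_unique ℓ.O_ne_I (left_mem_join _ _) hI (left_mem_join _ _) (right_mem_join _ _)
  exact ℓ.B₁_notMem (e' ▸ right_mem_join ℓ.O ℓ.B₁)

/-- The point `P₁` of the addition: the parallel to `OI` through `B₁` meets the parallel to
`OB₁` through `A`. -/
def sumAux (A : ℓ.Pt) : P :=
  meet (par ℓ.line ℓ.B₁) (par (join L ℓ.O ℓ.B₁) A.1) (ℓ.not_parallel_sum A.1)

/-- `A + B`: the parallel to `BB₁` through `P₁` meets `OI`. -/
def add (A B : ℓ.Pt) : ℓ.Pt :=
  ⟨meet (par (join L B.1 ℓ.B₁) (ℓ.sumAux A)) ℓ.line (ℓ.not_parallel_par B.2 _),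
    meet_mem_right _⟩

/-- The point `P₁` of the multiplication: the parallel to `IB₁` through `A` meets `OB₁`. -/
def prodAux (A : ℓ.Pt) : P :=
  meet (par (join L ℓ.I ℓ.B₁) A.1) (join L ℓ.O ℓ.B₁) (ℓ.not_parallel_prod A.1)

/-- `A · B`: the parallel to `BB₁` through `P₁` meets `OI`. -/
def mul (A B : ℓ.Pt) : ℓ.Pt :=
  ⟨meet (par (join L B.1 ℓ.B₁) (ℓ.prodAux A)) ℓ.line (ℓ.not_parallel_par B.2 _),
    meet_mem_right _⟩

theorem exists_meet_eq {Q : P} (hQ : Q ∉ ℓ.line) (D : ℓ.Pt) :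
    ∃ X : ℓ.Pt,
      meet (par (join L X.1 ℓ.B₁) Q) ℓ.line (ℓ.not_parallel_par X.2 _) = D.1 := by
  have hk : ¬ Parallel P (par (join L D.1 Q) ℓ.B₁) ℓ.line := fun h =>
    hQ (eq_of_parallel (parallel_trans (parallel_symm (par_parallel _ _)) h)
      (left_mem_join D.1 Q) D.2 ▸ right_mem_join D.1 Q)
  refine ⟨⟨_, meet_mem_right hk⟩, eq_meet _ ?_ D.2⟩
  have hne : meet _ _ hk ≠ ℓ.B₁ := fun h => ℓ.B₁_notMem (h ▸ meet_mem_right hk)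
  have e : join L (meet _ _ hk) ℓ.B₁ = par (join L D.1 Q) ℓ.B₁ :=
    line_unique hne (left_mem_join _ _) (right_mem_join _ _) (meet_mem_left hk) (mem_par _ _)
  have e' : par (join L (meet _ _ hk) ℓ.B₁) Q = join L D.1 Q :=
    eq_of_parallel (parallel_trans (par_parallel _ _) (by rw [e]; exact par_parallel _ _))
      (mem_par _ _) (right_mem_join _ _)
  have hD := left_mem_join (L := L) D.1 Q
  rw [← e'] at hD
  exact hD

theorem exists_add_eq_zero (A : ℓ.Pt) : ∃ X : ℓ.Pt, ℓ.add A X = ℓ.zero := by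
  have hQ : ℓ.sumAux A ∉ ℓ.line := fun h => by
    have e : par ℓ.line ℓ.B₁ = join L ℓ.O ℓ.I :=
      eq_of_parallel (par_parallel _ _) (meet_mem_left (ℓ.not_parallel_sum A.1)) h
    exact ℓ.B₁_notMem (e ▸ mem_par ℓ.line ℓ.B₁)
  obtain ⟨X, hX⟩ := ℓ.exists_meet_eq hQ ℓ.zero
  exact ⟨X, Subtype.ext hX⟩

theorem exists_mul_eq_one {A : ℓ.Pt} (hA : A ≠ ℓ.zero) : ∃ X : ℓ.Pt, ℓ.mul A X = ℓ.one := by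
  have hQ : ℓ.prodAux A ∉ ℓ.line := fun h => by
    have h1 : ℓ.prodAux A ∈ par (join L ℓ.I ℓ.B₁) A.1 := meet_mem_left _
    have h2 : ℓ.prodAux A ∈ join L ℓ.O ℓ.B₁ := meet_mem_right _
    have hO : ℓ.prodAux A = ℓ.O := by
      by_contra hn
      exact ℓ.not_parallel_line ℓ.zero.2
        (Or.inl (line_unique hn h2 (left_mem_join _ _) h (left_mem_join _ _)))
    have hAO : A.1 ≠ ℓ.O := fun e => hA (Subtype.ext e)
    exact ℓ.not_parallel_par ℓ.one.2 A.1
      (Or.inl (line_unique hAO (mem_par _ _) (hO ▸ h1) A.2 (left_mem_join _ _)))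
  obtain ⟨X, hX⟩ := ℓ.exists_meet_eq hQ ℓ.one
  exact ⟨X, Subtype.ext hX⟩

/-- `-A`: the point with `A + (-A) = O`. -/
def neg (A : ℓ.Pt) : ℓ.Pt := Classical.choose (ℓ.exists_add_eq_zero A)

/-- `A - B = A + (-B)`. -/
def sub (A B : ℓ.Pt) : ℓ.Pt := ℓ.add A (ℓ.neg B)

open Classical in
/-- `A⁻¹`: the point with `A · A⁻¹ = I`, for `A ≠ O` (with the convention `O⁻¹ = O`). -/
def inv (A : ℓ.Pt) : ℓ.Pt :=
  if h : A = ℓ.zero then ℓ.zero else Classical.choose (ℓ.exists_mul_eq_one h)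

/-- The ratio of three points, `r(A, B; C) = (B - C)⁻¹ · (A - C)`, meaningful for `B ≠ C`. -/
def ratio (A B C : ℓ.Pt) : ℓ.Pt := ℓ.mul (ℓ.inv (ℓ.sub B C)) (ℓ.sub A C)

/-- The natural dilatation `δₙ(A) = nA = A + ⋯ + A` (`n` summands). -/
def natDilatation : ℕ → ℓ.Pt → ℓ.Pt
  | 0, _ => ℓ.zero
  | n + 1, A => ℓ.add (natDilatation n A) A

end LineFrame

end

/-!
The line `OI` is coordinatized by the translations of the plane (Artin's method), after which the
claim is a computation with scalars.

*Translations.* A dilatation is a map of the plane that carries the points of each line to points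
of a parallel line; it is determined by two of its values (`IsDilatation.ext`). A translation is a
dilatation that moves all points in one direction; it is determined by one value
(`Translation.ext_of_apply`). The parallel and the concurrent case of Desargues' axiom together
give `Pencil.Moves.exists_perspectivity`, which is used twice: for each two points `p`, `q` there
is a translation `p ↦ q`, and for each point `A` of `OI` there is a dilatation `O ↦ O`, `I ↦ A`.
The translations form a commutative group.

*Scalars.* The endomorphisms of this group that preserve directions act as scalars: a scalar that
kills a nonzero translation is zero (`PreservesDirections.eq_zero`). A dilatation with fixed point
`O` induces such a scalar (`linearPart`), and so does every natural number `n`.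

*The line.* Let `vec A` be the translation `O ↦ A`. The points `P₁` of the two constructions are
the images of `B₁` under `vec A` and under the homothety `I ↦ A`. Hence `vec` turns sums of points
into sums of translations (`vec_add`), and `vec (A · B) = f (vec B)` for the scalar `f` with
`f (vec I) = vec A` (`exists_scalar`). If `f (vec I) = vec B - vec C`, then the ratio of `A`, `B`,
`C` is the point `X` with `f (vec X) = vec A - vec C` (`scalar_vec_ratio`). For `nA`, `nB`, `nC`
the scalar becomes `n * f` and the right-hand side is multiplied by `n`. Since `nI ≠ O`, the scalar
`n` is injective and cancels.
-/

noncomputable section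

namespace AffinePlane

variable {P L : Type*} [Membership P L] [AffinePlane P L]

/-! ### Parallels and joins -/

theorem eq_par {l m : L} {p : P} (h : Parallel P m l) (hp : p ∈ m) : m = par l p :=
  eq_of_parallel (parallel_trans h (parallel_symm (par_parallel l p))) hp (mem_par l p)

theorem par_congr {l m : L} (h : Parallel P l m) (p : P) : par l p = par m p :=
  eq_par (parallel_trans (par_parallel l p) h) (mem_par l p)

theorem par_eq_self {l : L} {p : P} (h : p ∈ l) : par l p = l :=
  (eq_par (Or.inl rfl) h).symm

theorem par_eq_of_mem {l : L} {p q : P} (h : q ∈ par l p) : par l q = par l p :=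
  (eq_par (par_parallel l p) h).symm

theorem mem_par_symm {l : L} {p q : P} (h : q ∈ par l p) : p ∈ par l q :=
  par_eq_of_mem h ▸ mem_par l p

theorem par_par (l : L) (p q : P) : par (par l p) q = par l q :=
  par_congr (par_parallel l p) q

theorem parallel_of_par_eq {l m : L} {p : P} (h : par l p = par m p) : Parallel P l m :=
  parallel_trans (parallel_symm (par_parallel l p)) (h ▸ par_parallel m p)

theorem join_eq {l : L} {p q : P} (h : p ≠ q) (hp : p ∈ l) (hq : q ∈ l) : join L p q = l :=
  line_unique h (left_mem_join p q) (right_mem_join p q) hp hq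

theorem join_comm {p q : P} (h : p ≠ q) : join L p q = join L q p :=
  join_eq h (right_mem_join q p) (left_mem_join q p)

theorem eq_of_mem_par {l m : L} (h : ¬ Parallel P l m) {p q x y : P} (hx : x ∈ par l p)
    (hy : y ∈ par l p) (hx' : x ∈ par m q) (hy' : y ∈ par m q) : x = y := by
  by_contra hn
  have e : par l p = par m q := line_unique hn hx hy hx' hy'
  exact h (parallel_trans (parallel_symm (par_parallel l p)) (e ▸ par_parallel m q))

theorem exists_notMem (l : L) : ∃ p : P, p ∉ l := by
  obtain ⟨a, b, c, -, -, -, h⟩ := exists_triangle (P := P) (L := L)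
  by_contra hn
  push Not at hn
  exact h l ⟨hn a, hn b, hn c⟩

theorem exists_ne {P : Type*} (L : Type*) [Membership P L] [AffinePlane P L] (p : P) :
    ∃ q : P, q ≠ p := by
  obtain ⟨a, b, -, hab, -⟩ := exists_triangle (P := P) (L := L)
  by_cases h : a = p
  · exact ⟨b, fun e => hab (h.trans e.symm)⟩
  · exact ⟨a, h⟩

/-- Every line has two points: otherwise two different lines through one point would miss it. -/
theorem exists_mem_ne (l : L) (p : P) : ∃ q ∈ l, q ≠ p := by
  by_contra hn
  push Not at hn
  obtain ⟨c, hc⟩ := exists_ne L p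
  obtain ⟨d, hd⟩ := exists_notMem (join L p c)
  have hp := left_mem_join (L := L) p c
  have hc' := right_mem_join (L := L) p c
  have hdp : d ≠ p := fun e => hd (e ▸ hp)
  have hdc : d ≠ c := fun e => hd (e ▸ hc')
  have hdl : d ∉ l := fun h => hdp (hn d h)
  have h1 : p ∉ join L d c := fun h =>
    hd (line_unique hc.symm h (right_mem_join d c) hp hc' ▸ left_mem_join d c)
  have h2 : par (join L p c) d ≠ join L p c := fun e => hd (e ▸ mem_par (join L p c) d)
  have h3 : p ∉ par (join L p c) d := fun h =>
    h2 (eq_of_parallel (par_parallel _ _) h hp)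
  have e := (playfair d l hdl).unique
    (y₁ := join L d c) (y₂ := par (join L p c) d)
    ⟨left_mem_join d c, fun x hx hx' => h1 (hn x hx ▸ hx')⟩
    ⟨mem_par _ _, fun x hx hx' => h3 (hn x hx ▸ hx')⟩
  exact h2 (eq_of_parallel (par_parallel _ _) (e ▸ right_mem_join d c) hc')

/-! ### Dilatations -/

/-- A dilatation maps the points of a line to points of one parallel line. Constant maps are
allowed. -/
def IsDilatation (L : Type*) [Membership P L] [AffinePlane P L] (σ : P → P) : Prop :=
  ∀ (l : L) (p q : P), p ∈ l → q ∈ l → σ q ∈ par l (σ p)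

theorem isDilatation_id : IsDilatation L (id : P → P) := fun l p q hp hq => by
  rw [id, id, par_eq_self hp]
  exact hq

theorem isDilatation_const (c : P) : IsDilatation L (fun _ : P => c) :=
  fun l _ _ _ _ => AffinePlane.mem_par l c

theorem IsDilatation.mem_par {σ : P → P} (h : IsDilatation L σ) {l : L} {p q : P}
    (hq : q ∈ par l p) : σ q ∈ par l (σ p) := by
  have := h (par l p) p q (AffinePlane.mem_par l p) hq
  rwa [par_par] at this

theorem IsDilatation.mem_par_join {σ : P → P} (h : IsDilatation L σ) (p q : P) :
    σ q ∈ par (join L p q) (σ p) :=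
  h _ p q (left_mem_join p q) (right_mem_join p q)

theorem IsDilatation.comp {σ τ : P → P} (hσ : IsDilatation L σ) (hτ : IsDilatation L τ) :
    IsDilatation L (σ ∘ τ) := fun l p q hp hq => hσ.mem_par (hτ l p q hp hq)

/-- A dilatation is determined by its values at two points. -/
theorem IsDilatation.ext {σ τ : P → P} (hσ : IsDilatation L σ) (hτ : IsDilatation L τ)
    {a b : P} (hab : a ≠ b) (ha : σ a = τ a) (hb : σ b = τ b) : σ = τ := by
  have key : ∀ {a b p : P}, a ≠ b → σ a = τ a → σ b = τ b → p ∉ join L a b → σ p = τ p := by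
    intro a b p hab ha hb hp
    have hpa : a ≠ p := fun e => hp (e ▸ left_mem_join a b)
    refine eq_of_mem_par (l := join L a p) (m := join L b p) (p := σ a) (q := σ b) ?_
      (hσ.mem_par_join a p) (ha ▸ hτ.mem_par_join a p) (hσ.mem_par_join b p)
      (hb ▸ hτ.mem_par_join b p)
    refine fun h => hp ?_
    have e := eq_of_parallel h (right_mem_join a p) (right_mem_join b p)
    rw [join_eq hab (left_mem_join a p) (e ▸ left_mem_join b p)]
    exact right_mem_join a p
  funext p
  by_cases hp : p ∈ join L a b
  · by_cases hpa : p = a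
    · rw [hpa, ha]
    obtain ⟨c, hc⟩ := exists_notMem (join L a b)
    have hac : a ≠ c := fun e => hc (e ▸ left_mem_join a b)
    refine key hac ha (key hab ha hb hc) fun h => hc ?_
    rw [line_unique hpa hp (left_mem_join a b) h (left_mem_join a c)]
    exact right_mem_join a c
  · exact key hab ha hb hp

/-- A dilatation that moves points in one direction and has a fixed point is the identity. -/
theorem IsDilatation.eq_id {σ : P → P} (hσ : IsDilatation L σ) {l : L}
    (hl : ∀ p, σ p ∈ par l p) {p : P} (hp : σ p = p) : σ = id := by
  obtain ⟨q, hq⟩ := exists_notMem (par l p)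
  have hpq : p ≠ q := fun e => hq (e ▸ AffinePlane.mem_par l p)
  refine hσ.ext isDilatation_id hpq hp (eq_of_mem_par (l := l) (m := join L p q) ?_ (hl q)
    (AffinePlane.mem_par l q) (hσ.mem_par_join p q) ?_)
  · intro h
    rw [par_congr h, par_eq_self (left_mem_join p q)] at hq
    exact hq (right_mem_join p q)
  · rw [hp, par_eq_self (left_mem_join p q)]
    exact right_mem_join p q

/-- The lines joining points to their images under a dilatation without fixed points are all
parallel: a common point of two of them would be fixed. -/
theorem IsDilatation.exists_direction {σ : P → P} (hσ : IsDilatation L σ)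
    (h : ∀ p, σ p ≠ p) : ∃ l : L, ∀ p, σ p ∈ par l p := by
  obtain ⟨p₀, -⟩ := exists_triangle (P := P) (L := L)
  have hl : σ p₀ ∈ join L p₀ (σ p₀) := right_mem_join _ _
  have hl' : p₀ ∈ join L p₀ (σ p₀) := left_mem_join _ _
  generalize join L p₀ (σ p₀) = l at hl hl'
  have hinv : ∀ x ∈ l, σ x ∈ l := fun x hx => by
    have := hσ l p₀ x hl' hx
    rwa [par_eq_self hl] at this
  refine ⟨l, fun q => ?_⟩
  by_cases hq : q ∈ l
  · rw [par_eq_self hq]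
    exact hinv q hq
  have hm : σ q ∈ join L q (σ q) := right_mem_join _ _
  have hm' : q ∈ join L q (σ q) := left_mem_join _ _
  generalize join L q (σ q) = m at hm hm'
  suffices hp : Parallel P m l from eq_par hp hm' ▸ hm
  by_contra hp
  obtain ⟨x, hxm, hxl⟩ := exists_meet hp
  have hx := hσ m q x hm' hxm
  rw [par_eq_self hm] at hx
  exact hq (line_unique (h x) (hinv x hxl) hxl hx hxm ▸ hm')

/-! ### Translations -/

variable (P L) in
/-- A translation: a dilatation that moves all points in one direction. The identity is a
translation, in every direction. -/
structure Translation where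
  /-- The underlying map of points. -/
  toFun : P → P
  isDilatation : IsDilatation L toFun
  exists_direction : ∃ l : L, ∀ p, toFun p ∈ par l p

namespace Translation

instance : CoeFun (Translation P L) fun _ => P → P := ⟨toFun⟩

theorem coe_injective {σ τ : Translation P L} (h : (σ : P → P) = τ) : σ = τ := by
  cases σ; cases τ; cases h; rfl

instance : Zero (Translation P L) :=
  ⟨⟨id, isDilatation_id, (exists_triangle (P := P) (L := L)).elim fun p _ =>
    ⟨join L p p, fun q => mem_par _ q⟩⟩⟩

@[simp] theorem zero_apply (p : P) : (0 : Translation P L) p = p := rfl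

theorem eq_zero {τ : Translation P L} {p : P} (h : τ p = p) : τ = 0 :=
  coe_injective (τ.exists_direction.elim fun _ hl => τ.isDilatation.eq_id hl h)

/-- A translation moves all points in the direction in which it moves one of them. -/
theorem mem_par_of_mem {τ : Translation P L} {l : L} {p : P} (h : τ p ∈ par l p) (q : P) :
    τ q ∈ par l q := by
  by_cases hp : τ p = p
  · rw [eq_zero hp]
    exact mem_par l q
  · obtain ⟨m, hm⟩ := τ.exists_direction
    have e := line_unique hp h (mem_par l p) (hm p) (mem_par m p)
    rw [par_congr (parallel_of_par_eq e)]
    exact hm q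

/-- A translation is determined by its value at one point. -/
theorem ext_of_apply {σ τ : Translation P L} {p : P} (h : σ p = τ p) : σ = τ := by
  obtain ⟨l, hl⟩ := σ.exists_direction
  have hl' := mem_par_of_mem (τ := τ) (h ▸ hl p)
  obtain ⟨q, hq⟩ := exists_notMem (par l p)
  have hpq : p ≠ q := fun e => hq (e ▸ mem_par l p)
  refine coe_injective (σ.isDilatation.ext τ.isDilatation hpq h
    (eq_of_mem_par (l := l) (m := join L p q) ?_ (hl q) (hl' q)
    (σ.isDilatation.mem_par_join p q) (h ▸ τ.isDilatation.mem_par_join p q)))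
  intro h
  rw [par_congr h, par_eq_self (left_mem_join p q)] at hq
  exact hq (right_mem_join p q)

/-- If a composite of two translations has a fixed point, then both have the same direction;
otherwise `IsDilatation.exists_direction` applies. -/
theorem exists_direction_comp (σ τ : Translation P L) :
    ∃ l : L, ∀ p, σ (τ p) ∈ par l p := by
  by_cases h : ∃ p, σ (τ p) = p
  · obtain ⟨p, hp⟩ := h
    by_cases hτ : τ p = p
    · rw [eq_zero hτ]
      exact σ.exists_direction
    · obtain ⟨l, hl⟩ := τ.exists_direction
      have hσ : σ (τ p) ∈ par l (τ p) := by
        rw [hp]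
        exact mem_par_symm (hl p)
      exact ⟨l, fun q => par_eq_of_mem (hl q) ▸ mem_par_of_mem hσ (τ q)⟩
  · push Not at h
    exact (σ.isDilatation.comp τ.isDilatation).exists_direction h

instance : Add (Translation P L) :=
  ⟨fun σ τ => ⟨σ ∘ τ, σ.isDilatation.comp τ.isDilatation, exists_direction_comp σ τ⟩⟩

@[simp] theorem add_apply (σ τ : Translation P L) (p : P) : (σ + τ) p = σ (τ p) := rfl

end Translation

/-! ### Perspectivities of pencils -/

section Pencil

variable {P L : Type*} [Membership P L] [AffinePlane P L]

variable (P L) in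
/-- A pencil of lines, either all lines through a vertex or all lines of one direction. The
regular points are those that are not the vertex; each lies on exactly one line of the pencil. -/
structure Pencil where
  /-- The line of the pencil through a regular point. -/
  line : P → L
  /-- The points other than the vertex. -/
  Regular : P → Prop
  mem_line : ∀ p, p ∈ line p
  line_eq : ∀ {p q}, Regular q → q ∈ line p → line q = line p
  mem_of_not_regular : ∀ {x}, ¬ Regular x → ∀ p, x ∈ line p
  parallel_or_concurrent : ∀ p q r,
    (Parallel P (line p) (line q) ∧ Parallel P (line q) (line r)) ∨
      ∃ V : P, V ∈ line p ∧ V ∈ line q ∧ V ∈ line r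
  /-- There is a third line in the pencil unless the lines of the pencil have just two points. -/
  exists_third : ∀ p q, Regular p → Regular q → line p ≠ line q →
    (∃ r, Regular r ∧ line r ≠ line p ∧ line r ≠ line q) ∨
      ∀ x ∈ line p, ∀ y ∈ line p, ∀ z ∈ line p, x ≠ y → x ≠ z → y = z

/-- The pencil of lines through a point. -/
def centralPencil (L : Type*) [Membership P L] [AffinePlane P L] (V : P) : Pencil P L where
  line p := join L V p
  Regular p := p ≠ V
  mem_line p := right_mem_join V p
  line_eq hq h := join_eq hq.symm (left_mem_join _ _) h
  mem_of_not_regular hx p := by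
    rw [not_not.1 hx]
    exact left_mem_join V p
  parallel_or_concurrent p q r :=
    Or.inr ⟨V, left_mem_join _ _, left_mem_join _ _, left_mem_join _ _⟩
  exists_third p q hp hq h := by
    refine Or.inl ?_
    -- The parallel to `pq` through `V` differs from `Vp` and from `Vq`.
    obtain ⟨r, hr, hrV⟩ := exists_mem_ne (par (join L p q) V) V
    have hj : join L V r = par (join L p q) V := join_eq hrV.symm (mem_par _ _) hr
    have key : ∀ x, x ∈ join L p q → join L V r ≠ join L V x := by
      intro x hx e
      have e' : par (join L p q) V = join L p q :=
        eq_of_parallel (par_parallel _ _) (hj ▸ e ▸ right_mem_join V x) hx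
      have hV : V ∈ join L p q := e' ▸ mem_par (join L p q) V
      exact h ((join_eq hp.symm hV (left_mem_join p q)).trans
        (join_eq hq.symm hV (right_mem_join p q)).symm)
    exact ⟨r, hrV, key p (left_mem_join p q), key q (right_mem_join p q)⟩

/-- If a parallel class consists of only two lines, then its lines have at most two points. With
three points `x`, `y`, `z` on one line and a point `q` on the other, project `y` and `z` parallel
to `qx` to `Y` and `Z` on the other line; then the parallel to `qx` through `y` contains both
`Y` and `Z`. -/
theorem eq_of_two_parallels {m k : L} (hmk : ∀ x : P, x ∈ m → x ∉ k)
    (h : ∀ r : P, r ∈ m ∨ r ∈ k) {q : P} (hq : q ∈ k) {x y z : P} (hx : x ∈ m) (hy : y ∈ m)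
    (hz : z ∈ m) (hxy : x ≠ y) (hxz : x ≠ z) : y = z := by
  by_contra hyz
  have hxt : x ∈ join L q x := right_mem_join q x
  have hqt : q ∈ join L q x := left_mem_join q x
  generalize join L q x = t at hxt hqt
  have htm : t ≠ m := fun e => hmk q (e ▸ hqt) hq
  have htk : t ≠ k := fun e => hmk x hx (e ▸ hxt)
  have hyt : y ∉ t := fun hyt => htm (line_unique hxy hxt hyt hx hy)
  have hzt : z ∉ t := fun hzt => htm (line_unique hxz hxt hzt hx hz)
  have hnp : ∀ w : P, ¬ Parallel P (par t w) k := fun w hw =>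
    htk (eq_of_parallel (parallel_trans (parallel_symm (par_parallel t w)) hw) hqt hq)
  obtain ⟨Y, hYy, hYk⟩ := exists_meet (hnp y)
  obtain ⟨Z, hZz, hZk⟩ := exists_meet (hnp z)
  have hZq : Z ≠ q := by
    rintro rfl
    exact hzt (eq_of_parallel (par_parallel t z) hZz hqt ▸ mem_par t z)
  have hYZ : Y ≠ Z := by
    rintro rfl
    have e : par t y = par t z := (par_eq_of_mem hYy).symm.trans (par_eq_of_mem hZz)
    have e' : par t y = m := line_unique hyz (mem_par t y) (e ▸ mem_par t z) hy hz
    exact htm (eq_of_parallel (par_parallel t y) (e' ▸ hx) hxt ▸ e')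
  have hys : y ∈ join L y Z := left_mem_join y Z
  have hZs : Z ∈ join L y Z := right_mem_join y Z
  generalize join L y Z = s at hys hZs
  have hst : Parallel P s t := by
    refine Or.inr fun w hws hwt => ?_
    rcases h w with hw | hw
    · have hwy : w ≠ y := fun e => hyt (e ▸ hwt)
      exact hmk Z (line_unique hwy hws hys hw hy ▸ hZs) hZk
    · have hwZ : w ≠ Z := fun e => htk (line_unique hZq (e ▸ hwt) hqt hZk hq)
      exact hmk y hy (line_unique hwZ hws hZs hw hZk ▸ hys)
  have hsk : s = k := line_unique hYZ (eq_par hst hys ▸ hYy) hZs hYk hZk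
  exact hmk y hy (hsk ▸ hys)

/-- The pencil of lines parallel to a given line. -/
def parallelPencil (P : Type*) {L : Type*} [Membership P L] [AffinePlane P L] (l : L) :
    Pencil P L where
  line p := par l p
  Regular _ := True
  mem_line p := mem_par l p
  line_eq _ h := par_eq_of_mem h
  mem_of_not_regular hx := absurd trivial hx
  parallel_or_concurrent p q r := Or.inl
    ⟨parallel_trans (par_parallel l p) (parallel_symm (par_parallel l q)),
      parallel_trans (par_parallel l q) (parallel_symm (par_parallel l r))⟩
  exists_third p q _ _ h := by
    by_cases hr : ∃ r : P, par l r ≠ par l p ∧ par l r ≠ par l q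
    · obtain ⟨r, hr⟩ := hr
      exact Or.inl ⟨r, trivial, hr⟩
    · push Not at hr
      refine Or.inr fun x hx y hy z hz hxy hxz =>
        eq_of_two_parallels (k := par l q) (q := q)
          (fun w hw hw' => h ((par_eq_of_mem hw).symm.trans (par_eq_of_mem hw')))
          (fun r => ?_) (mem_par l q) hx hy hz hxy hxz
      by_cases hrp : par l r = par l p
      · exact Or.inl (hrp ▸ mem_par l r)
      · exact Or.inr (hr r hrp ▸ mem_par l r)

namespace Pencil

variable (π : Pencil P L)

/-- `p'` is a regular point other than the regular point `p`, on the same line of the pencil. -/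
def Moves (p p' : P) : Prop := π.Regular p ∧ π.Regular p' ∧ p ≠ p' ∧ p' ∈ π.line p

variable {π}

theorem not_parallel_join {a p : P} (ha : π.Regular a) (h : π.line p ≠ π.line a) :
    ¬ Parallel P (join L a p) (π.line p) := fun hp => by
  have e := eq_of_parallel hp (right_mem_join a p) (π.mem_line p)
  exact h (π.line_eq ha (e ▸ left_mem_join a p)).symm

theorem eq_of_mem_par_join {a p : P} (ha : π.Regular a) (h : π.line p ≠ π.line a)
    {c x y : P} (hx : x ∈ π.line p) (hy : y ∈ π.line p) (hx' : x ∈ par (join L a p) c)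
    (hy' : y ∈ par (join L a p) c) : x = y := by
  rw [← par_eq_self (π.mem_line p)] at hx hy
  exact eq_of_mem_par (not_parallel_join ha h) hx' hy' hx hy

theorem exists_moves {a a' p : P} (h : π.Moves a a') (hp : π.Regular p)
    (hpa : π.line p ≠ π.line a) : ∃ p', π.Moves p p' ∧ p' ∈ par (join L a p) a' := by
  obtain ⟨ha, ha', hne, hmem⟩ := h
  have hn : ¬ Parallel P (par (join L a p) a') (π.line p) := fun hn =>
    not_parallel_join ha hpa (parallel_trans (parallel_symm (par_parallel _ _)) hn)
  obtain ⟨p', h1, h2⟩ := exists_meet hn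
  have hj : join L a p ≠ π.line a := fun e =>
    hpa (π.line_eq hp (e ▸ right_mem_join a p))
  refine ⟨p', ⟨hp, ?_, ?_, h2⟩, h1⟩
  · by_contra hr
    have hpa' : p' ≠ a' := fun e => hr (e ▸ ha')
    have e : par (join L a p) a' = π.line a :=
      line_unique hpa' h1 (mem_par _ _) (π.mem_of_not_regular hr a) hmem
    exact hj (eq_of_parallel (parallel_symm (par_parallel _ a')) (left_mem_join a p)
      (e ▸ π.mem_line a) |>.trans e)
  · rintro rfl
    have e : join L a p = par (join L a p) a' :=
      eq_of_parallel (parallel_symm (par_parallel _ a')) (right_mem_join a p) h1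
    exact hj (line_unique hne (left_mem_join a p) (e ▸ mem_par _ a') (π.mem_line a) hmem)

end Pencil

end Pencil

/-! ### Existence of translations and homotheties -/

section Desargues

variable {P L : Type*} [Membership P L] [DesarguesAffinePlane P L] {π : Pencil P L}

namespace Pencil

/-- Desargues' axiom for a triangle with vertices on three different lines of a pencil; the lines
`a'b'` and `b'c'` are given as parallels. -/
theorem Moves.desargues {a a' b b' c c' : P} (ha : π.Moves a a') (hb : π.Moves b b')
    (hc : π.Moves c c') (hab : π.line a ≠ π.line b) (hbc : π.line b ≠ π.line c)
    (hac : π.line a ≠ π.line c) (h₁ : b' ∈ par (join L a b) a')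
    (h₂ : c' ∈ par (join L b c) b') : c' ∈ par (join L a c) a' := by
  have hj : ∀ {x x'}, π.Moves x x' → join L x x' = π.line x := fun h =>
    join_eq h.2.2.1 (π.mem_line _) h.2.2.2
  have hne : ∀ {x x' y y'}, π.Moves x x' → π.Moves y y' → π.line x ≠ π.line y →
      x ≠ y ∧ x' ≠ y' := fun {x x' y y'} hx hy h => ⟨fun e => h (by rw [e]), fun e => h <|
    (π.line_eq hx.2.1 hx.2.2.2).symm.trans (by rw [e]; exact π.line_eq hy.2.1 hy.2.2.2)⟩
  have hp : ∀ {x x' y y'}, π.Moves x x' → π.Moves y y' → π.line x ≠ π.line y →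
      y' ∈ par (join L x y) x' → Parallel P (join L x y) (join L x' y') :=
    fun hx hy h hm => by
      rw [join_eq (hne hx hy h).2 (mem_par _ _) hm]
      exact parallel_symm (par_parallel _ _)
  have key := DesarguesAffinePlane.desargues (L := L) a b c a' b' c' ha.2.2.1 hb.2.2.1 hc.2.2.1
    (hne ha hb hab).1 (hne hb hc hbc).1 (hne ha hc hac).1 (hne ha hb hab).2 (hne hb hc hbc).2
    (hne ha hc hac).2
  rw [hj ha, hj hb, hj hc] at key
  have := key hab hbc hac (π.parallel_or_concurrent a b c) (hp ha hb hab h₁) (hp hb hc hbc h₂)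
  rw [← eq_par (parallel_symm this) (left_mem_join a' c')]
  exact right_mem_join a' c'

/-- The perspectivity along a pencil that carries `a` to `a'`. Away from the line `aa'` a point
is carried along with `a`, and on this line it is carried along with an auxiliary point `b`.
That lines go to parallel lines is Desargues' axiom, except for lines that join the line `aa'`
with the line of the pencil through `b`; for these a third line of the pencil serves as an
intermediary, or all lines have just two points. -/
theorem Moves.exists_perspectivity {a a' : P} (h : π.Moves a a') :
    ∃ σ : P → P, σ a = a' ∧ (∀ p, π.Regular p → π.Moves p (σ p)) ∧
      ∀ p q, π.Regular p → π.Regular q → p ≠ q → σ q ∈ par (join L p q) (σ p) := by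
  obtain ⟨b, hb⟩ := exists_notMem (π.line a)
  have hbr : π.Regular b := by
    by_contra hn
    exact hb (π.mem_of_not_regular hn a)
  have hba : π.line b ≠ π.line a := fun e => hb (e ▸ π.mem_line b)
  obtain ⟨b', hbm, hbc⟩ := exists_moves h hbr hba
  have hex : ∀ p, ∃ p', π.Regular p → π.Moves p p' ∧
      (π.line p ≠ π.line a → p' ∈ par (join L a p) a') ∧
      (π.line p = π.line a → p' ∈ par (join L b p) b') := by
    intro p
    by_cases hp : π.Regular p
    · by_cases e : π.line p = π.line a
      · obtain ⟨p', hp', hm⟩ := exists_moves hbm hp (e ▸ hba.symm)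
        exact ⟨p', fun _ => ⟨hp', fun hn => absurd e hn, fun _ => hm⟩⟩
      · obtain ⟨p', hp', hm⟩ := exists_moves h hp e
        exact ⟨p', fun _ => ⟨hp', fun _ => hm, fun hn => absurd hn e⟩⟩
    · exact ⟨p, fun h => absurd h hp⟩
  choose σ hσ using hex
  have hmv : ∀ {p}, π.Regular p → π.Moves p (σ p) := fun hp => (hσ _ hp).1
  have hne : ∀ {p q}, π.line p ≠ π.line q → p ≠ q := fun h e => h (by rw [e])
  have sym : ∀ {p q}, π.line p ≠ π.line q → σ q ∈ par (join L p q) (σ p) →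
      σ p ∈ par (join L q p) (σ q) := fun h hm => by
    rw [← join_comm (hne h)]
    exact mem_par_symm hm
  have ha : σ a = a' := by
    refine eq_of_mem_par_join hbr hba.symm (hmv h.1).2.2.2 h.2.2.2 ((hσ a h.1).2.2 rfl) ?_
    rw [← join_comm (hne hba.symm)]
    exact mem_par_symm hbc
  have hb' : σ b = b' :=
    eq_of_mem_par_join h.1 hba (hmv hbr).2.2.2 hbm.2.2.2 ((hσ b hbr).2.1 hba) hbc
  have from_a : ∀ {p}, π.Regular p → π.line p ≠ π.line a → σ p ∈ par (join L a p) (σ a) :=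
    fun hp hn => by
      rw [ha]
      exact (hσ _ hp).2.1 hn
  have from_b : ∀ {p}, π.Regular p → π.line p = π.line a → σ p ∈ par (join L b p) (σ b) :=
    fun hp hn => by
      rw [hb']
      exact (hσ _ hp).2.2 hn
  have des : ∀ {p q r}, π.Regular p → π.Regular q → π.Regular r → π.line p ≠ π.line q →
      π.line q ≠ π.line r → π.line p ≠ π.line r → σ q ∈ par (join L p q) (σ p) →
      σ r ∈ par (join L q r) (σ q) → σ r ∈ par (join L p r) (σ p) :=
    fun hp hq hr => (hmv hp).desargues (hmv hq) (hmv hr)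
  have off_off : ∀ {p q}, π.Regular p → π.Regular q → π.line p ≠ π.line a →
      π.line q ≠ π.line a → π.line p ≠ π.line q → σ q ∈ par (join L p q) (σ p) :=
    fun hp hq hpa hqa hpq => des hp h.1 hq hpa hqa.symm hpq
      (sym hpa.symm (from_a hp hpa)) (from_a hq hqa)
  have off_on : ∀ {p q}, π.Regular p → π.Regular q → π.line p ≠ π.line a →
      π.line q = π.line a → σ q ∈ par (join L p q) (σ p) := by
    intro p q hp hq hpa hqa
    by_cases hpb : π.line p = π.line b
    · by_cases hpb' : p = b
      · rw [hpb']
        exact from_b hq hqa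
      by_cases hthird : ∃ r, π.Regular r ∧ π.line r ≠ π.line p ∧ π.line r ≠ π.line a
      · obtain ⟨r, hr, hrp, hra⟩ := hthird
        have hrb := hpb ▸ hrp
        have hqr : π.line r ≠ π.line q := hqa ▸ hra
        exact des hp hr hq hrp.symm hqr (hqa ▸ hpa) (off_off hp hr hpa hra hrp.symm)
          (des hr hbr hq hrb (hqa ▸ hba) hqr (off_off hr hbr hra hba hrb) (from_b hq hqa))
      · -- Here `p`, `b` are the points of one line and `σ` exchanges them.
        have htwo := (π.exists_third p a hp h.1 hpa).resolve_left hthird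
        have htwo' := (π.exists_third a p h.1 hp hpa.symm).resolve_left
          fun ⟨r, hr, hra, hrp⟩ => hthird ⟨r, hr, hrp, hra⟩
        have hσp : σ p = b := htwo p (π.mem_line p) _ (hmv hp).2.2.2 b (hpb ▸ π.mem_line b)
          (hmv hp).2.2.1 hpb'
        have hσb : σ b = p := htwo b (hpb ▸ π.mem_line b) _ (hpb ▸ (hmv hbr).2.2.2) p
          (π.mem_line p) (hmv hbr).2.2.1 (Ne.symm hpb')
        by_cases hqa' : q = a
        · rw [hqa']
          exact sym hpa.symm (from_a hp hpa)
        have hqm : q ∈ π.line a := hqa ▸ π.mem_line q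
        have hσa : σ a = q := htwo' a (π.mem_line a) _ (hmv h.1).2.2.2 q hqm
          (hmv h.1).2.2.1 (Ne.symm hqa')
        have hσq : σ q = a := htwo' q hqm _ (hqa ▸ (hmv hq).2.2.2) a (π.mem_line a)
          (hmv hq).2.2.1 hqa'
        have hab := from_a hbr hba
        rw [hσa, hσb] at hab
        rw [hσp, hσq, join_comm (hne (hqa ▸ hpa)),
          join_eq (hne (hqa ▸ hpa.symm)) (mem_par _ _) hab, par_par,
          par_eq_self (right_mem_join a b)]
        exact left_mem_join a b
    · exact des hp hbr hq hpb (hqa ▸ hba) (hqa ▸ hpa) (off_off hp hbr hpa hba hpb)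
        (from_b hq hqa)
  refine ⟨σ, ha, fun p => hmv, fun p q hp hq hpq => ?_⟩
  by_cases e : π.line p = π.line q
  · have hmem := (hmv hq).2.2.2
    rw [← e] at hmem
    rw [join_eq hpq (π.mem_line p) (e ▸ π.mem_line q), par_eq_self (hmv hp).2.2.2]
    exact hmem
  · by_cases hpa : π.line p = π.line a
    · have hqa : π.line q ≠ π.line a := fun h => e (hpa.trans h.symm)
      exact sym (Ne.symm e) (off_on hq hp hqa hpa)
    · by_cases hqa : π.line q = π.line a
      · exact off_on hp hq hpa hqa
      · exact off_off hp hq hpa hqa e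

end Pencil

theorem exists_translation (L : Type*) {P : Type*} [Membership P L] [DesarguesAffinePlane P L]
    (p q : P) : ∃ τ : Translation P L, τ p = q := by
  by_cases h : p = q
  · exact ⟨0, h⟩
  have hm : (parallelPencil P (join L p q)).Moves p q := by
    refine ⟨trivial, trivial, h, ?_⟩
    change q ∈ par (join L p q) p
    rw [par_eq_self (left_mem_join p q)]
    exact right_mem_join p q
  obtain ⟨σ, hp, hσ, hpar⟩ := hm.exists_perspectivity
  refine ⟨⟨σ, fun l x y hx hy => ?_, join L p q, fun x => (hσ x trivial).2.2.2⟩, hp⟩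
  by_cases hxy : x = y
  · rw [hxy]
    exact mem_par l _
  · exact join_eq hxy hx hy ▸ hpar x y trivial trivial hxy

/-- For `a` on the line `oi` there is a dilatation that fixes `o` and carries `i` to `a`; it is
constant if `a = o`. -/
theorem exists_homothety {o i a : P} (hoi : o ≠ i) (ha : a ∈ join L o i) :
    ∃ σ : P → P, IsDilatation L σ ∧ σ o = o ∧ σ i = a := by
  by_cases hia : i = a
  · exact ⟨id, isDilatation_id, rfl, hia⟩
  by_cases hao : a = o
  · exact ⟨fun _ => o, isDilatation_const o, rfl, hao.symm⟩
  have hm : (centralPencil L o).Moves i a := ⟨hoi.symm, hao, hia, ha⟩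
  obtain ⟨σ, hi, hσ, hpar⟩ := hm.exists_perspectivity
  classical
  have hmem : ∀ {x : P}, x ≠ o → σ x ∈ join L o x := fun hx => (hσ _ hx).2.2.2
  refine ⟨fun x => if x = o then o else σ x, fun l x y hx hy => ?_, if_pos rfl, ?_⟩
  · by_cases hxy : x = y
    · rw [hxy]
      exact mem_par l _
    dsimp only
    by_cases hxo : x = o
    · subst hxo
      rw [if_pos rfl, if_neg (Ne.symm hxy), par_eq_self hx, ← join_eq hxy hx hy]
      exact hmem (Ne.symm hxy)
    · by_cases hyo : y = o
      · subst hyo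
        rw [if_pos rfl, if_neg hxo]
        refine mem_par_symm ?_
        rw [par_eq_self hy, ← join_eq (Ne.symm hxy) hy hx]
        exact hmem hxo
      · rw [if_neg hxo, if_neg hyo]
        exact join_eq hxy hx hy ▸ hpar x y hxo hyo hxy
  · dsimp only
    rw [if_neg hoi.symm, hi]

end Desargues

/-! ### The group of translations and its direction-preserving endomorphisms -/

namespace Translation

variable {P L : Type*} [Membership P L] [DesarguesAffinePlane P L]

variable (L) in
/-- The translation that carries `p` to `q`. -/
def ofPair (p q : P) : Translation P L := Classical.choose (exists_translation L p q)

@[simp] theorem ofPair_apply (p q : P) : ofPair L p q p = q :=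
  Classical.choose_spec (exists_translation L p q)

theorem add_comm_of_direction {σ τ : Translation P L} {l : L} (hσ : ∀ p, σ p ∈ par l p) {p : P}
    (hτ : τ p ∉ par l p) : σ + τ = τ + σ := by
  have hm : ∀ q, τ q ∈ par (join L p (τ p)) q :=
    mem_par_of_mem (p := p) (by
      rw [par_eq_self (left_mem_join p (τ p))]
      exact right_mem_join p (τ p))
  refine ext_of_apply (p := p) (eq_of_mem_par (l := l) (m := join L p (τ p)) (fun h => ?_)
    (hσ (τ p)) (τ.isDilatation.mem_par (hσ p)) (σ.isDilatation.mem_par (hm p)) (hm (σ p)))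
  rw [par_congr h] at hτ
  exact hτ (hm p)

/-- Translations of the same direction commute because each of them commutes with all
translations of other directions. -/
theorem add_comm_aux (σ τ : Translation P L) : σ + τ = τ + σ := by
  obtain ⟨l, hσ⟩ := σ.exists_direction
  obtain ⟨p, -⟩ := exists_triangle (P := P) (L := L)
  by_cases hτ : τ p ∈ par l p
  · obtain ⟨c, hc⟩ := exists_notMem (par l p)
    have hρ : ofPair L p c p ∉ par l p := by rwa [ofPair_apply]
    have hτρ : (τ + ofPair L p c) p ∉ par l p := fun h => by
      rw [add_apply, ofPair_apply] at h
      exact hc (par_eq_of_mem h ▸ mem_par_symm (mem_par_of_mem hτ c))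
    have e₁ := add_comm_of_direction hσ hρ
    have e₂ := add_comm_of_direction hσ hτρ
    refine ext_of_apply (p := ofPair L p c p) ?_
    calc (σ + (τ + ofPair L p c)) p = τ ((ofPair L p c + σ) p) := by rw [e₂]; rfl
      _ = τ ((σ + ofPair L p c) p) := by rw [e₁]
  · exact add_comm_of_direction hσ hτ

instance : Neg (Translation P L) :=
  ⟨fun τ => ofPair L (τ (exists_triangle (P := P) (L := L)).choose)
    (exists_triangle (P := P) (L := L)).choose⟩

instance : AddCommGroup (Translation P L) where
  add_assoc _ _ _ := rfl
  zero_add _ := rfl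
  add_zero _ := rfl
  neg_add_cancel τ := eq_zero (p := (exists_triangle (P := P) (L := L)).choose)
    (ofPair_apply _ _)
  add_comm := add_comm_aux
  nsmul := nsmulRec
  zsmul := zsmulRec

/-- The translations in the direction of a line. -/
def along (l : L) : AddSubgroup (Translation P L) where
  carrier := {τ | ∀ p, τ p ∈ par l p}
  zero_mem' p := mem_par l p
  add_mem' hσ hτ p := par_eq_of_mem (hτ p) ▸ hσ _
  neg_mem' {τ} hτ := mem_par_of_mem
    (p := τ (exists_triangle (P := P) (L := L)).choose) ((ofPair_apply (L := L) _ _).symm ▸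
      mem_par_symm (hτ _))

theorem mem_along {l : L} {τ : Translation P L} : τ ∈ along l ↔ ∀ p, τ p ∈ par l p := Iff.rfl

theorem mem_along_of_apply {l : L} {τ : Translation P L} {p : P} (h : τ p ∈ par l p) :
    τ ∈ along l := mem_par_of_mem h

theorem parallel_of_mem_along {τ : Translation P L} (h0 : τ ≠ 0) {l m : L} (hl : τ ∈ along l)
    (hm : τ ∈ along m) : Parallel P l m := by
  obtain ⟨p, -⟩ := exists_triangle (P := P) (L := L)
  exact parallel_of_par_eq (line_unique (fun h => h0 (eq_zero h)) (hl p) (mem_par l p) (hm p)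
    (mem_par m p))

theorem along_congr {l m : L} (h : Parallel P l m) :
    (along l : AddSubgroup (Translation P L)) = along m := by
  ext τ
  simp only [mem_along, par_congr h]

/-- Endomorphisms of the translation group that map each translation to one of the same
direction. They are the scalars of the plane. -/
def PreservesDirections (f : AddMonoid.End (Translation P L)) : Prop :=
  ∀ (l : L), ∀ τ ∈ along l, f τ ∈ along l

theorem PreservesDirections.sub {f g : AddMonoid.End (Translation P L)}
    (hf : PreservesDirections f) (hg : PreservesDirections g) : PreservesDirections (f - g) :=
  fun l τ hτ => (along l).sub_mem (hf l τ hτ) (hg l τ hτ)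

theorem PreservesDirections.mul {f g : AddMonoid.End (Translation P L)}
    (hf : PreservesDirections f) (hg : PreservesDirections g) : PreservesDirections (f * g) :=
  fun l τ hτ => hf l _ (hg l τ hτ)

theorem preservesDirections_natCast (n : ℕ) :
    PreservesDirections (n : AddMonoid.End (Translation P L)) := fun l τ hτ => by
  rw [AddMonoid.End.natCast_apply]
  exact (along l).nsmul_mem hτ n

/-- A direction-preserving endomorphism that kills a nonzero translation `τ` is zero: if `υ` has
another direction than `τ`, then `f υ = f (υ + τ)` has the directions of both `υ` and `υ + τ`. -/
theorem PreservesDirections.eq_zero {f : AddMonoid.End (Translation P L)}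
    (hf : PreservesDirections f) {τ : Translation P L} (h0 : τ ≠ 0) (h : f τ = 0) : f = 0 := by
  obtain ⟨l, hl⟩ : ∃ l : L, τ ∈ along l := τ.exists_direction
  have off : ∀ υ : Translation P L, υ ∉ along l → f υ = 0 := by
    intro υ hυ
    by_contra hn
    obtain ⟨m, hm⟩ : ∃ m : L, υ ∈ along m := υ.exists_direction
    obtain ⟨k, hk⟩ : ∃ k : L, υ + τ ∈ along k := (υ + τ).exists_direction
    have hfk := hf k _ hk
    rw [map_add, h, add_zero] at hfk
    have hmk := parallel_of_mem_along hn (hf m _ hm) hfk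
    rw [← along_congr hmk] at hk
    have hτm : τ ∈ along m := by
      have := (along m).sub_mem hk hm
      rwa [add_sub_cancel_left] at this
    rw [along_congr (parallel_of_mem_along h0 hτm hl)] at hm
    exact hυ hm
  ext1 υ
  by_cases hυ : υ ∈ along l
  · obtain ⟨p, -⟩ := exists_triangle (P := P) (L := L)
    obtain ⟨c, hc⟩ := exists_notMem (par l p)
    have hρ : ofPair L p c ∉ along l := fun h => hc (by simpa using h p)
    have hρυ : ofPair L p c + υ ∉ along l := fun h => hρ (by
      have := (along l).sub_mem h hυ
      rwa [add_sub_cancel_right] at this)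
    have := off _ hρυ
    rwa [map_add, off _ hρ, zero_add] at this
  · exact off υ hυ

theorem PreservesDirections.ext {f g : AddMonoid.End (Translation P L)}
    (hf : PreservesDirections f) (hg : PreservesDirections g) {τ : Translation P L} (h0 : τ ≠ 0)
    (h : f τ = g τ) : f = g :=
  sub_eq_zero.1 ((hf.sub hg).eq_zero h0 (sub_eq_zero.2 h))

theorem PreservesDirections.injective {f : AddMonoid.End (Translation P L)}
    (hf : PreservesDirections f) (h : f ≠ 0) : Function.Injective f :=
  (injective_iff_map_eq_zero f).2 fun _ hτ => by_contra fun hn => h (hf.eq_zero hn hτ)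

/-- A dilatation `σ` with fixed point `o` carries the translation `o ↦ p` to the translation
`o ↦ σ p`. -/
theorem ofPair_comp_dilatation {σ : P → P} (hσ : IsDilatation L σ) {o : P} (ho : σ o = o)
    (τ : Translation P L) (p : P) : ofPair L o (σ (τ o)) (σ p) = σ (τ p) := by
  obtain ⟨l, hl⟩ := τ.exists_direction
  have hl' : ofPair L o (σ (τ o)) ∈ along l := mem_along_of_apply (p := o) (by
    rw [ofPair_apply]
    simpa only [ho] using hσ.mem_par (hl o))
  obtain ⟨q, hq⟩ := exists_notMem (par l o)
  have hoq : o ≠ q := fun e => hq (e ▸ mem_par l o)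
  have e₁ : ofPair L o (σ (τ o)) (σ o) = σ (τ o) := by rw [ho, ofPair_apply]
  refine congrFun (((isDilatation _).comp hσ).ext (hσ.comp τ.isDilatation) hoq e₁
    (eq_of_mem_par (l := l) (m := join L o q) (fun h => hq ?_) (hl' (σ q)) (hσ.mem_par (hl q))
    ?_ (hσ.mem_par (τ.isDilatation.mem_par_join o q)))) p
  · rw [par_congr h, par_eq_self (left_mem_join o q)]
    exact right_mem_join o q
  · have := (isDilatation (ofPair L o (σ (τ o)))).mem_par (hσ.mem_par_join o q)
    rwa [e₁] at this

/-- The endomorphism of the translation group induced by a dilatation `σ` with fixed point `o`: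
the linear part of `σ`. -/
def linearPart {σ : P → P} (hσ : IsDilatation L σ) {o : P} (ho : σ o = o) :
    AddMonoid.End (Translation P L) where
  toFun τ := ofPair L o (σ (τ o))
  map_zero' := ext_of_apply (p := o) (by simp only [ofPair_apply, zero_apply, ho])
  map_add' τ υ := ext_of_apply (p := o) (by
    rw [ofPair_apply, Translation.add_apply, Translation.add_apply, ofPair_apply,
      ofPair_comp_dilatation hσ ho])

theorem linearPart_apply {σ : P → P} (hσ : IsDilatation L σ) {o : P} (ho : σ o = o)
    (τ : Translation P L) : linearPart hσ ho τ = ofPair L o (σ (τ o)) := rfl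

theorem preservesDirections_linearPart {σ : P → P} (hσ : IsDilatation L σ) {o : P}
    (ho : σ o = o) : PreservesDirections (linearPart hσ ho) := fun l τ hτ =>
  mem_along_of_apply (p := o) (by
    rw [linearPart_apply, ofPair_apply]
    simpa only [ho] using hσ.mem_par (hτ o))

end Translation

end AffinePlane

/-! ### Points of the line as translations -/

namespace LineFrame

open AffinePlane Translation

variable {P L : Type*} [Membership P L] [DesarguesAffinePlane P L] (ℓ : LineFrame P L)

/-- The translation that carries `O` to a point of the line `OI`. -/
def vec (A : ℓ.Pt) : Translation P L := ofPair L ℓ.O A.1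

theorem vec_apply (A : ℓ.Pt) : ℓ.vec A ℓ.O = A.1 := ofPair_apply _ _

theorem vec_injective : Function.Injective ℓ.vec := fun A B h =>
  Subtype.ext (by rw [← vec_apply, h, vec_apply])

theorem vec_zero : ℓ.vec ℓ.zero = 0 := eq_zero (p := ℓ.O) (ℓ.vec_apply ℓ.zero)

theorem vec_eq_zero {A : ℓ.Pt} : ℓ.vec A = 0 ↔ A = ℓ.zero := by
  rw [← vec_zero, ℓ.vec_injective.eq_iff]

theorem vec_one_ne_zero : ℓ.vec ℓ.one ≠ 0 := fun h =>
  ℓ.O_ne_I (congrArg Subtype.val (ℓ.vec_eq_zero.1 h)).symm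

theorem vec_mem_along (A : ℓ.Pt) : ℓ.vec A ∈ along ℓ.line :=
  mem_along_of_apply (p := ℓ.O) (by
    have hO : ℓ.O ∈ ℓ.line := ℓ.zero.2
    rw [vec_apply, par_eq_self hO]
    exact A.2)

/-- `P₁` is the image of `B₁` under the translation `O ↦ A`, and `A + B` is that of `B`. -/
theorem vec_add (A B : ℓ.Pt) : ℓ.vec (ℓ.add A B) = ℓ.vec A + ℓ.vec B := by
  have h₁ : ℓ.sumAux A = ℓ.vec A ℓ.B₁ := eq_meet _ (ℓ.vec_mem_along A ℓ.B₁) (by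
    have := (ℓ.vec A).isDilatation.mem_par_join ℓ.O ℓ.B₁
    rwa [vec_apply] at this)
  have h₂ : (ℓ.add A B).1 = ℓ.vec A B.1 := by
    refine eq_meet (ℓ.not_parallel_par B.2 _) ?_ ?_
    · rw [h₁]
      exact (ℓ.vec A).isDilatation _ _ _ (right_mem_join _ _) (left_mem_join _ _)
    · have := ℓ.vec_mem_along A B.1
      rwa [par_eq_self B.2] at this
  exact ext_of_apply (p := ℓ.O) (by rw [vec_apply, h₂, Translation.add_apply, vec_apply])

theorem vec_neg (A : ℓ.Pt) : ℓ.vec (ℓ.neg A) = -ℓ.vec A := by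
  have h : ℓ.add A (ℓ.neg A) = ℓ.zero := Classical.choose_spec (ℓ.exists_add_eq_zero A)
  refine (neg_eq_of_add_eq_zero_right ?_).symm
  rw [← vec_add, h, vec_zero]

theorem vec_sub (A B : ℓ.Pt) : ℓ.vec (ℓ.sub A B) = ℓ.vec A - ℓ.vec B := by
  rw [sub, vec_add, vec_neg, sub_eq_add_neg]

theorem vec_natDilatation (n : ℕ) (A : ℓ.Pt) : ℓ.vec (ℓ.natDilatation n A) = n • ℓ.vec A := by
  induction n with
  | zero => rw [natDilatation, vec_zero, zero_nsmul]
  | succ n ih => rw [natDilatation, vec_add, ih, succ_nsmul]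

/-- Left multiplication by `A` is the scalar given by the homothety `σ` with `σ O = O` and
`σ I = A`: `P₁` is the image of `B₁` under `σ`, and `A · B` is that of `B`. -/
theorem exists_scalar (A : ℓ.Pt) : ∃ f : AddMonoid.End (Translation P L),
    PreservesDirections f ∧ f (ℓ.vec ℓ.one) = ℓ.vec A ∧
      ∀ B, f (ℓ.vec B) = ℓ.vec (ℓ.mul A B) := by
  obtain ⟨σ, hσ, hO, hI⟩ := exists_homothety ℓ.O_ne_I A.2
  have hf : ∀ B, linearPart hσ hO (ℓ.vec B) = ofPair L ℓ.O (σ B.1) := fun B => by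
    rw [linearPart_apply, vec_apply]
  refine ⟨linearPart hσ hO, preservesDirections_linearPart hσ hO, ?_, fun B => ?_⟩
  · rw [hf, one, hI, vec]
  have hmem : ∀ {l : L} {x : P}, ℓ.O ∈ l → x ∈ l → σ x ∈ l := fun {l x} ho hx => by
    have := hσ l ℓ.O x ho hx
    rwa [hO, par_eq_self ho] at this
  have h₁ : ℓ.prodAux A = σ ℓ.B₁ := eq_meet _ (hI ▸ hσ.mem_par_join ℓ.I ℓ.B₁)
    (hmem (left_mem_join _ _) (right_mem_join _ _))
  have h₂ : (ℓ.mul A B).1 = σ B.1 := by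
    refine eq_meet (ℓ.not_parallel_par B.2 _) ?_ (hmem ℓ.zero.2 B.2)
    rw [h₁]
    exact hσ _ _ _ (right_mem_join _ _) (left_mem_join _ _)
  rw [hf, vec, h₂]

/-- The ratio is the solution `X` of `(B - C) · X = A - C`. -/
theorem scalar_vec_ratio {A B C : ℓ.Pt} (hBC : B ≠ C) {f : AddMonoid.End (Translation P L)}
    (hf : PreservesDirections f) (hfI : f (ℓ.vec ℓ.one) = ℓ.vec B - ℓ.vec C) :
    f (ℓ.vec (ℓ.ratio A B C)) = ℓ.vec A - ℓ.vec C := by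
  have hD : ℓ.sub B C ≠ ℓ.zero := fun h => by
    rw [← vec_eq_zero, vec_sub, sub_eq_zero] at h
    exact hBC (ℓ.vec_injective h)
  have hinv : ℓ.mul (ℓ.sub B C) (ℓ.inv (ℓ.sub B C)) = ℓ.one := by
    rw [inv, dif_neg hD]
    exact Classical.choose_spec (ℓ.exists_mul_eq_one hD)
  obtain ⟨g, hg, hgI, hgm⟩ := ℓ.exists_scalar (ℓ.sub B C)
  obtain ⟨k, hk, hkI, hkm⟩ := ℓ.exists_scalar (ℓ.inv (ℓ.sub B C))
  have hfg : f = g := hf.ext hg ℓ.vec_one_ne_zero (by rw [hfI, hgI, vec_sub])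
  have hgk : g * k = (1 : ℕ) := (hg.mul hk).ext (preservesDirections_natCast 1)
    ℓ.vec_one_ne_zero (by
      rw [AddMonoid.End.coe_mul, Function.comp_apply, hkI, hgm, hinv,
        AddMonoid.End.natCast_apply, one_nsmul])
  rw [ratio, ← hkm, hfg, ← vec_sub]
  refine (DFunLike.congr_fun hgk _).trans ?_
  rw [AddMonoid.End.natCast_apply, one_nsmul]

/-- Both ratios solve the same equation, because the scalars `n` and `f` with
`f (vec I) = vec B - vec C` are injective. -/
theorem ratio_natDilatation {ℓ : LineFrame P L} {n : ℕ}
    (hn : ℓ.natDilatation n ℓ.one ≠ ℓ.zero) (A : ℓ.Pt) {B C : ℓ.Pt} (hBC : B ≠ C) :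
    ℓ.natDilatation n B ≠ ℓ.natDilatation n C ∧
      ℓ.ratio (ℓ.natDilatation n A) (ℓ.natDilatation n B) (ℓ.natDilatation n C) =
        ℓ.ratio A B C := by
  have hn0 : (n : AddMonoid.End (Translation P L)) ≠ 0 := fun h => hn <| by
    rw [← vec_eq_zero, vec_natDilatation, ← AddMonoid.End.natCast_apply, h]
    rfl
  have hne : ℓ.natDilatation n B ≠ ℓ.natDilatation n C := fun h => hBC <| by
    apply_fun ℓ.vec at h
    rw [vec_natDilatation, vec_natDilatation, ← AddMonoid.End.natCast_apply,
      ← AddMonoid.End.natCast_apply] at h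
    exact ℓ.vec_injective ((preservesDirections_natCast n).injective hn0 h)
  refine ⟨hne, ?_⟩
  obtain ⟨f, hf, hfI, -⟩ := ℓ.exists_scalar (ℓ.sub B C)
  rw [vec_sub] at hfI
  -- The scalar of `nB - nC` is `n * f`.
  have h₁ := ℓ.scalar_vec_ratio (A := A) hBC hf hfI
  have h₂ := ℓ.scalar_vec_ratio (A := ℓ.natDilatation n A) hne
    ((preservesDirections_natCast n).mul hf) (by
      rw [AddMonoid.End.coe_mul, Function.comp_apply, hfI, AddMonoid.End.natCast_apply,
        vec_natDilatation, vec_natDilatation, nsmul_sub])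
  rw [vec_natDilatation, vec_natDilatation, ← nsmul_sub, ← h₁, AddMonoid.End.coe_mul,
    Function.comp_apply, ← AddMonoid.End.natCast_apply] at h₂
  have hf0 : f ≠ 0 := fun h => hBC <| ℓ.vec_injective <| by
    rw [h] at hfI
    exact (sub_eq_zero.1 hfI.symm)
  exact ℓ.vec_injective (hf.injective hf0 ((preservesDirections_natCast n).injective hn0 h₂))

end LineFrame

end

theorem mainTheorem11 {P L : Type*} [Membership P L] [DesarguesAffinePlane P L]
    (ℓ : LineFrame P L) (n : ℕ) (hn : ℓ.natDilatation n ℓ.one ≠ ℓ.zero)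
    (A B C : ℓ.Pt) (hBC : B ≠ C) :
    ℓ.natDilatation n B ≠ ℓ.natDilatation n C ∧
      ℓ.ratio (ℓ.natDilatation n A) (ℓ.natDilatation n B) (ℓ.natDilatation n C) =
        ℓ.ratio A B C :=
  LineFrame.ratio_natDilatation hn A hBC
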